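/- Let $A,B,C\in\mathbb{R}$, $\sigma_1,\sigma_2>0$, $\delta\in(-1,1)$ and $q>0$ be fixed, with $\sigma_1,\sigma_2,\delta$ known. For every sample size $n$ let $Z\in\mathbb{R}^n$ be a (fixed or random) treatment vector, and let $$M=ZA+E_1,\qquad R=ZC+MB+E_2,$$ where the errors $(E_1,E_2)$ are independent of $Z$ and $$\operatorname{vec}\begin{pmatrix}E_1&E_2\end{pmatrix}\sim\mathcal N\left(\mathbf 0,\ \boldsymbol\Sigma\otimes \boldsymbol I_n\right),\qquad \boldsymbol\Sigma=\begin{pmatrix}\sigma_1^2&\delta\sigma_1\sigma_2\\ \delta\sigma_1\sigma_2&\sigma_2^2\end{pmatrix}.$$ Suppose that $Z^\top Z/n\to q$ in probability as $n\to\infty$ (for a fixed design this is ordinary convergence). Consider the total-effect estimator $\hat C'$ and the direct-effect estimator $\hat C$, $$\hat C'=\frac{Z^\top R}{Z^\top Z},\qquad \hat C=\frac{M^\top M\,Z^\top R-Z^\top M\,M^\top R}{Z^\top Z\,M^\top M-M^\top Z\,Z^\top M}+\frac{\delta\sigma_2\,Z^\top M}{\sigma_1\,Z^\top Z}.$$ Then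 $$\sqrt n\left(\begin{pmatrix}\hat C'\\ \hat C\end{pmatrix}-\begin{pmatrix}C+AB\\ C\end{pmatrix}\right)\ \overset{\mathcal D}{\longrightarrow}\ \mathcal N(\mathbf 0,\boldsymbol V'),$$ where $\boldsymbol V'$ is the positive semidefinite matrix $$\boldsymbol V'=\begin{pmatrix}\dfrac{B^2\sigma_1^2+2B\delta\sigma_1\sigma_2+\sigma_2^2}{q}&\dfrac{\sigma_2^2+B\delta\sigma_1\sigma_2}{q}\\[2ex] \dfrac{\sigma_2^2+B\delta\sigma_1\sigma_2}{q}&\dfrac{\sigma_2^2\left(qA^2+\sigma_1^2-qA^2\delta^2\right)}{q\sigma_1^2}\end{pmatrix}.$$ -/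

import Mathlib

open MeasureTheory ProbabilityTheory Filter Topology Matrix
open scoped Kronecker

/-- The `2 × 2` covariance matrix of the pair of errors of one unit: standard deviations `σ₁`, `σ₂`
and correlation `δ`. -/
def errorCov (σ₁ σ₂ δ : ℝ) : Matrix (Fin 2) (Fin 2) ℝ :=
  !![σ₁ ^ 2, δ * σ₁ * σ₂; δ * σ₁ * σ₂, σ₂ ^ 2]

/-- `vec (E₁ E₂)`: the columns `E₁`, `E₂` of the `n × 2` error matrix stacked into one vector. The
index `(j, i)` stands for the entry of unit `i` in column `j`. -/
def vecErrors {n : ℕ} (E₁ E₂ : Fin n → ℝ) : EuclideanSpace ℝ (Fin 2 × Fin n) :=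
  WithLp.toLp 2 (fun p => (![E₁, E₂] : Fin 2 → Fin n → ℝ) p.1 p.2)

/-- The single level mediation model for `n` units with coefficients `A`, `C`, `B` and error
parameters `σ₁`, `σ₂`, `δ`: treatment `Z`, mediator `M = Z A + E₁`, outcome `R = Z C + M B + E₂`,
where `vec (E₁ E₂) ∼ N(0, Σ ⊗ Iₙ)` and the errors are independent of the treatment vector (which
is automatic when the treatment vector is not random). -/
structure IsMediationModel {Ω : Type*} [MeasurableSpace Ω] (P : Measure Ω) (A C B σ₁ σ₂ δ : ℝ)
    {n : ℕ} (Z M R E₁ E₂ : Ω → Fin n → ℝ) : Prop where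
  aemeasurable_treatment : AEMeasurable Z P
  errors_law : HasLaw (fun ω => vecErrors (E₁ ω) (E₂ ω))
    (multivariateGaussian 0 (errorCov σ₁ σ₂ δ ⊗ₖ (1 : Matrix (Fin n) (Fin n) ℝ))) P
  indep : IndepFun Z (fun ω => vecErrors (E₁ ω) (E₂ ω)) P
  mediator_eq : ∀ᵐ ω ∂P, M ω = A • Z ω + E₁ ω
  outcome_eq : ∀ᵐ ω ∂P, R ω = C • Z ω + B • M ω + E₂ ω

/-- The total effect estimator `Ĉ' = Zᵀ R / Zᵀ Z`. -/
noncomputable def totalEffectEst {n : ℕ} (Z R : Fin n → ℝ) : ℝ :=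
  (Z ⬝ᵥ R) / (Z ⬝ᵥ Z)

/-- The direct effect estimator `Ĉ` (the maximum likelihood estimator of `C` for known error
covariance). -/
noncomputable def directEffectEst (σ₁ σ₂ δ : ℝ) {n : ℕ} (Z M R : Fin n → ℝ) : ℝ :=
  ((M ⬝ᵥ M) * (Z ⬝ᵥ R) - (Z ⬝ᵥ M) * (M ⬝ᵥ R)) /
      ((Z ⬝ᵥ Z) * (M ⬝ᵥ M) - (M ⬝ᵥ Z) * (Z ⬝ᵥ M))
    + (δ * σ₂ * (Z ⬝ᵥ M)) / (σ₁ * (Z ⬝ᵥ Z))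

/-- The asymptotic covariance matrix `V'` of the pair `(Ĉ', Ĉ)`. -/
noncomputable def effectsAsympCov (A B σ₁ σ₂ δ q : ℝ) : Matrix (Fin 2) (Fin 2) ℝ :=
  !![(B ^ 2 * σ₁ ^ 2 + 2 * B * δ * σ₁ * σ₂ + σ₂ ^ 2) / q, (σ₂ ^ 2 + B * δ * σ₁ * σ₂) / q;
     (σ₂ ^ 2 + B * δ * σ₁ * σ₂) / q,
       σ₂ ^ 2 * (q * A ^ 2 + σ₁ ^ 2 - q * A ^ 2 * δ ^ 2) / (q * σ₁ ^ 2)]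

/-! Put `τ = σ₂ √(1 - δ²)`, which is positive, and write `E₁ = σ₁ X`, `E₂ = δ σ₂ X + τ Y`. Then `X`
and `Y` are standard Gaussian vectors, and `Z`, `X`, `Y` are independent
(`IsMediationModel.hasLaw_standardized`). Wherever the denominators do not vanish, the scaled
estimation errors are linear in `W = (ZᵀX / √(nq), ZᵀY / √(nq), XᵀY / √n)`, with coefficients
continuous in `(ZᵀZ/n, XᵀX/n, ZᵀX/n)` near its limit in probability `(q, 1, 0)`
(`sqrt_smul_estimators_sub_eq`).

No central limit theorem for sums is needed to get `W → N(0, I₃)`: given `(Z, X)`, the last two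
coordinates are exactly Gaussian, and given `Z` so is the first. Integrating out `Y` and then `X`
leaves exponentials of quadratic forms that converge in probability
(`tendstoInDistribution_dotProducts`). Slutsky's theorem then gives a linear image of a standard
Gaussian vector, whose covariance is `V'` (`map_effectsLimit_stdGaussian`). -/

/-! ### Convergence in probability to constants. -/

section ConvergenceInMeasure

variable {Ω ι : Type*} [MeasurableSpace Ω] {P : Measure Ω} {l : Filter ι}

/-- If `X i` tends to a constant `c` in measure, then it leaves any neighbourhood of `c` with
vanishing measure. -/
lemma TendstoInMeasure.tendsto_measure_notMem {E : Type*} [PseudoMetricSpace E]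
    {X : ι → Ω → E} {c : E} (hX : TendstoInMeasure P X l (fun _ ↦ c)) {U : Set E} (hU : U ∈ 𝓝 c) :
    Tendsto (fun i ↦ P {ω | X i ω ∉ U}) l (𝓝 0) := by
  obtain ⟨ε, hε, hball⟩ := Metric.mem_nhds_iff.1 hU
  refine tendsto_of_tendsto_of_tendsto_of_le_of_le tendsto_const_nhds
    (tendstoInMeasure_iff_dist.1 hX ε hε) (fun _ ↦ zero_le) fun i ↦ measure_mono fun ω hω ↦ ?_
  by_contra h
  exact hω (hball (by simpa using h))

/-- Continuous mapping for convergence in measure to a constant. -/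
lemma TendstoInMeasure.comp_continuousAt {E F : Type*} [PseudoMetricSpace E] [PseudoMetricSpace F]
    {X : ι → Ω → E} {c : E} (hX : TendstoInMeasure P X l (fun _ ↦ c)) {f : E → F}
    (hf : ContinuousAt f c) : TendstoInMeasure P (fun i ω ↦ f (X i ω)) l (fun _ ↦ f c) := by
  rw [tendstoInMeasure_iff_dist]
  intro ε hε
  convert TendstoInMeasure.tendsto_measure_notMem hX (hf (Metric.ball_mem_nhds (f c) hε))
    using 4 with i ω
  simp

lemma TendstoInMeasure.prodMk_const {E F : Type*} [PseudoMetricSpace E] [PseudoMetricSpace F]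
    {X : ι → Ω → E} {Y : ι → Ω → F} {c : E} {d : F} (hX : TendstoInMeasure P X l (fun _ ↦ c))
    (hY : TendstoInMeasure P Y l (fun _ ↦ d)) :
    TendstoInMeasure P (fun i ω ↦ (X i ω, Y i ω)) l (fun _ ↦ (c, d)) := by
  rw [tendstoInMeasure_iff_dist] at hX hY ⊢
  intro ε hε
  have h := (hX ε hε).add (hY ε hε)
  rw [add_zero] at h
  refine tendsto_of_tendsto_of_tendsto_of_le_of_le tendsto_const_nhds h (fun _ ↦ zero_le)
    fun i ↦ (measure_mono fun ω hω ↦ ?_).trans (measure_union_le _ _)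
  simpa [Prod.dist_eq] using hω

/-- Two sequences that differ only on sets of vanishing measure have a difference tending to zero in
measure. -/
lemma tendstoInMeasure_zero_of_tendsto_measure_ne {E : Type*} [SeminormedAddCommGroup E]
    {X : ι → Ω → E} {S : ι → Set Ω} (hS : Tendsto (fun i ↦ P (S i)) l (𝓝 0))
    (h : ∀ᶠ i in l, ∀ᵐ ω ∂P, ω ∉ S i → X i ω = 0) :
    TendstoInMeasure P X l 0 := by
  rw [tendstoInMeasure_iff_norm]
  intro ε hε
  refine tendsto_of_tendsto_of_tendsto_of_le_of_le' tendsto_const_nhds hS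
    (.of_forall fun _ ↦ zero_le) ?_
  filter_upwards [h] with i hi
  refine measure_mono_ae ?_
  filter_upwards [hi] with ω hω hmem
  by_contra hc
  have : ε ≤ ‖X i ω - 0‖ := hmem
  rw [hω hc] at this
  simp at this
  linarith

/-- Bounded convergence for convergence in measure to a constant. -/
lemma TendstoInMeasure.tendsto_integral_norm [IsProbabilityMeasure P] {E : Type*}
    [NormedAddCommGroup E] {X : ℕ → Ω → E} {c : E}
    (hX : TendstoInMeasure P X atTop (fun _ ↦ c)) (hm : ∀ n, AEStronglyMeasurable (X n) P)
    {K : ℝ} (hK : ∀ n, ∀ᵐ ω ∂P, ‖X n ω‖ ≤ K) :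
    Tendsto (fun n ↦ ∫ ω, ‖X n ω - c‖ ∂P) atTop (𝓝 0) := by
  -- Every subsequence has a further subsequence converging almost everywhere, where dominated
  -- convergence applies.
  refine tendsto_of_subseq_tendsto fun ns hns ↦ ?_
  obtain ⟨ms, -, hms⟩ := (hX.comp hns).exists_seq_tendsto_ae'
  refine ⟨ms, ?_⟩
  have h0 : ∫ _, (0 : ℝ) ∂P = 0 := by simp
  rw [← h0]
  refine tendsto_integral_of_dominated_convergence (fun _ ↦ K + ‖c‖)
    (fun n ↦ ((hm _).sub aestronglyMeasurable_const).norm) (integrable_const _) (fun n ↦ ?_) ?_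
  · filter_upwards [hK (ns (ms n))] with ω hω
    rw [norm_norm]
    exact (norm_sub_le _ _).trans (by gcongr)
  · filter_upwards [hms] with ω hω
    simpa using (hω.sub_const c).norm

/-- A sequence of real random variables whose characteristic functions tend to `1` tends to zero in
probability. -/
lemma tendstoInMeasure_zero_of_tendsto_charFun [IsProbabilityMeasure P] {X : ℕ → Ω → ℝ}
    (hm : ∀ n, AEMeasurable (X n) P)
    (h : ∀ t : ℝ, Tendsto (fun n ↦ charFun (P.map (X n)) t) atTop (𝓝 1)) :
    TendstoInMeasure P X atTop (fun _ ↦ 0) := by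
  rw [tendstoInMeasure_iff_norm]
  intro ε hε
  let μ : ℕ → ProbabilityMeasure ℝ := fun n ↦ ⟨P.map (X n), Measure.isProbabilityMeasure_map (hm n)⟩
  have hμ : Tendsto μ atTop (𝓝 ⟨Measure.dirac 0, inferInstance⟩) := by
    refine ProbabilityMeasure.tendsto_of_tendsto_charFun fun t ↦ ?_
    simpa [μ, charFun_dirac] using h t
  -- Portmanteau: the limit law `dirac 0` gives this closed set no mass.
  have hF : IsClosed {x : ℝ | ε ≤ ‖x‖} := isClosed_le continuous_const continuous_norm
  have := ProbabilityMeasure.limsup_measure_closed_le_of_tendsto hμ hF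
  have h0 : (Measure.dirac (0 : ℝ)) {x : ℝ | ε ≤ ‖x‖} = 0 := by
    rw [Measure.dirac_apply' _ hF.measurableSet]
    simp [hε]
  simp only [ProbabilityMeasure.coe_mk, h0, μ] at this
  have h2 : ∀ n, P.map (X n) {x : ℝ | ε ≤ ‖x‖} = P {ω | ε ≤ ‖X n ω - 0‖} := fun n ↦ by
    rw [Measure.map_apply_of_aemeasurable (hm n) hF.measurableSet]
    simp
  simp only [h2] at this
  exact tendsto_of_le_liminf_of_limsup_le zero_le this

end ConvergenceInMeasure

/-! ### Gaussian characteristic functions, conditionally on an independent variable. -/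

section GaussianVectors

open Complex

lemma integral_exp_dotProduct_pi_gaussianReal {ι : Type*} [Fintype ι] (t : ι → ℝ) :
    ∫ x, cexp (((x ⬝ᵥ t : ℝ) : ℂ) * I) ∂(Measure.pi fun _ : ι ↦ gaussianReal 0 1) =
      cexp (-((t ⬝ᵥ t : ℝ) : ℂ) / 2) := by
  have h : ∀ x : ι → ℝ, cexp (((x ⬝ᵥ t : ℝ) : ℂ) * I) = ∏ i, cexp ((t i : ℂ) * (x i : ℂ) * I) := by
    intro x
    rw [← Complex.exp_sum, ← Finset.sum_mul]
    simp [dotProduct, mul_comm]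
  simp_rw [h]
  rw [integral_fintype_prod_eq_prod (f := fun i (x : ℝ) ↦ cexp ((t i : ℂ) * (x : ℂ) * I))]
  simp_rw [← charFun_apply_real, charFun_gaussianReal, ← Complex.exp_sum]
  congr 1
  simp [dotProduct, neg_div, Finset.sum_div, pow_two]

/-- Integrating out a standard Gaussian vector `Y` that is independent of `U`. -/
lemma ProbabilityTheory.HasLaw.integral_mul_exp_dotProduct {Ω 𝓤 ι : Type*} [Fintype ι]
    [MeasurableSpace Ω] [MeasurableSpace 𝓤] {P : Measure Ω} {ρ : Measure 𝓤} [IsProbabilityMeasure ρ]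
    {U : Ω → 𝓤} {Y : Ω → ι → ℝ}
    (hUY : HasLaw (fun ω ↦ (U ω, Y ω)) (ρ.prod (Measure.pi fun _ : ι ↦ gaussianReal 0 1)) P)
    {f : 𝓤 → ℂ} (hf : Measurable f) (hf1 : ∀ u, ‖f u‖ ≤ 1) {h : 𝓤 → ι → ℝ} (hh : Measurable h) :
    ∫ ω, f (U ω) * cexp (((Y ω ⬝ᵥ h (U ω) : ℝ) : ℂ) * I) ∂P =
      ∫ ω, f (U ω) * cexp (-((h (U ω) ⬝ᵥ h (U ω) : ℝ) : ℂ) / 2) ∂P := by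
  have hfst : HasLaw U ρ P := HasLaw.fun_comp (Y := Prod.fst) ⟨by fun_prop, by simp⟩ hUY
  have m1 : Measurable fun u ↦ f u * cexp (-((h u ⬝ᵥ h u : ℝ) : ℂ) / 2) := by
    unfold dotProduct; fun_prop
  have m2 : Measurable fun v : 𝓤 × (ι → ℝ) ↦ f v.1 * cexp (((v.2 ⬝ᵥ h v.1 : ℝ) : ℂ) * I) := by
    unfold dotProduct; fun_prop
  have e1 := hfst.integral_comp m1.aestronglyMeasurable
  have e2 := hUY.integral_comp m2.aestronglyMeasurable
  simp only [Function.comp_def] at e1 e2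
  rw [e1, e2, integral_prod]
  · refine integral_congr_ae (.of_forall fun u ↦ ?_)
    simp only
    rw [integral_const_mul, integral_exp_dotProduct_pi_gaussianReal]
  · refine Integrable.of_bound m2.aestronglyMeasurable 1 (.of_forall fun v ↦ ?_)
    simp [Complex.norm_exp_ofReal_mul_I, hf1]

end GaussianVectors

/-! ### Standardization of the correlated errors. -/

section StandardizedErrors

open Complex

variable {Ω : Type*} [MeasurableSpace Ω] {P : Measure Ω}

/-- The Cholesky factor used here is the same one that expresses the errors through `X` and `Y`. -/
lemma errorCov_posSemidef {σ₁ σ₂ δ : ℝ} (hδ : δ ∈ Set.Icc (-1 : ℝ) 1) :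
    (errorCov σ₁ σ₂ δ).PosSemidef := by
  have h : errorCov σ₁ σ₂ δ = !![σ₁, 0; δ * σ₂, σ₂ * √(1 - δ ^ 2)] *
      (!![σ₁, 0; δ * σ₂, σ₂ * √(1 - δ ^ 2)])ᴴ := by
    have hs : √(1 - δ ^ 2) ^ 2 = 1 - δ ^ 2 := Real.sq_sqrt (by nlinarith [hδ.1, hδ.2])
    ext i j
    fin_cases i <;> fin_cases j <;>
      simp [errorCov, Matrix.mul_apply, Fin.sum_univ_two]
    · ring
    · ring
    · ring
    · linear_combination (-σ₂ ^ 2) * hs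
  rw [h]
  exact Matrix.posSemidef_self_mul_conjTranspose _

lemma measurable_vecErrors {α : Type*} [MeasurableSpace α] {n : ℕ} {f g : α → Fin n → ℝ}
    (hf : Measurable f) (hg : Measurable g) : Measurable fun a ↦ vecErrors (f a) (g a) := by
  unfold vecErrors
  refine (WithLp.measurable_toLp 2 _).comp (measurable_pi_iff.2 fun p ↦ ?_)
  obtain ⟨j, i⟩ := p
  fin_cases j
  · exact (measurable_pi_apply i).comp hf
  · exact (measurable_pi_apply i).comp hg

/-- The correlated Gaussian errors as a linear image of two independent standard Gaussian
vectors. -/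
lemma hasLaw_vecErrors_prod_gaussianReal {σ₁ σ₂ δ : ℝ} (hδ : δ ∈ Set.Icc (-1 : ℝ) 1) (n : ℕ) :
    HasLaw (fun v : (Fin n → ℝ) × (Fin n → ℝ) ↦
        vecErrors (σ₁ • v.1) ((δ * σ₂) • v.1 + (σ₂ * √(1 - δ ^ 2)) • v.2))
      (multivariateGaussian 0 (errorCov σ₁ σ₂ δ ⊗ₖ (1 : Matrix (Fin n) (Fin n) ℝ)))
      ((Measure.pi fun _ : Fin n ↦ gaussianReal 0 1).prod
        (Measure.pi fun _ : Fin n ↦ gaussianReal 0 1)) := by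
  have hm : Measurable (fun v : (Fin n → ℝ) × (Fin n → ℝ) ↦
        vecErrors (σ₁ • v.1) ((δ * σ₂) • v.1 + (σ₂ * √(1 - δ ^ 2)) • v.2)) :=
    measurable_vecErrors (by fun_prop) (by fun_prop)
  refine ⟨hm.aemeasurable, ?_⟩
  have := Measure.isProbabilityMeasure_map hm.aemeasurable (μ :=
    (Measure.pi fun _ : Fin n ↦ gaussianReal 0 1).prod
        (Measure.pi fun _ : Fin n ↦ gaussianReal 0 1))
  apply Measure.ext_of_charFun
  ext t
  have hpsd : (errorCov σ₁ σ₂ δ ⊗ₖ (1 : Matrix (Fin n) (Fin n) ℝ)).PosSemidef :=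
    (errorCov_posSemidef hδ).kronecker Matrix.PosSemidef.one
  rw [charFun_multivariateGaussian hpsd, charFun_apply,
    integral_map hm.aemeasurable (by fun_prop)]
  -- For each unit, `(a i, b i)` is the transposed Cholesky factor applied to `(t (0, i), t (1,
  -- i))`.
  set a : Fin n → ℝ := fun i ↦ σ₁ * t (0, i) + δ * σ₂ * t (1, i) with ha
  set b : Fin n → ℝ := fun i ↦ σ₂ * √(1 - δ ^ 2) * t (1, i) with hb
  have key : ∀ v : (Fin n → ℝ) × (Fin n → ℝ),
      cexp ((inner ℝ (vecErrors (σ₁ • v.1) ((δ * σ₂) • v.1 + (σ₂ * √(1 - δ ^ 2)) • v.2)) t : ℝ) * I)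
        = cexp (((v.1 ⬝ᵥ a : ℝ) : ℂ) * I) * cexp (((v.2 ⬝ᵥ b : ℝ) : ℂ) * I) := by
    intro v
    rw [← Complex.exp_add, ← add_mul, ← ofReal_add]
    congr 3
    simp only [PiLp.inner_apply, vecErrors, Fintype.sum_prod_type, Fin.sum_univ_two, dotProduct,
      ← Finset.sum_add_distrib, ha, hb]
    refine Finset.sum_congr rfl fun i _ ↦ ?_
    simp
    ring
  simp_rw [key]
  rw [integral_prod_mul (f := fun x : Fin n → ℝ ↦ cexp (((x ⬝ᵥ a : ℝ) : ℂ) * I))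
    (g := fun x : Fin n → ℝ ↦ cexp (((x ⬝ᵥ b : ℝ) : ℂ) * I)),
    integral_exp_dotProduct_pi_gaussianReal, integral_exp_dotProduct_pi_gaussianReal,
    ← Complex.exp_add]
  congr 1
  have hs : √(1 - δ ^ 2) ^ 2 = 1 - δ ^ 2 := Real.sq_sqrt (by nlinarith [hδ.1, hδ.2])
  have hq : (t : Fin 2 × Fin n → ℝ) ⬝ᵥ (errorCov σ₁ σ₂ δ ⊗ₖ (1 : Matrix (Fin n) (Fin n) ℝ)) *ᵥ t
      = a ⬝ᵥ a + b ⬝ᵥ b := by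
    simp only [dotProduct, mulVec, Fintype.sum_prod_type, Fin.sum_univ_two,
      Matrix.kroneckerMap_apply, ← Finset.sum_add_distrib, ha, hb, Matrix.one_apply, mul_ite,
      ite_mul, mul_one, mul_zero, zero_mul, Finset.sum_ite_eq, Finset.mem_univ, if_true]
    refine Finset.sum_congr rfl fun i _ ↦ ?_
    simp [errorCov]
    linear_combination (-(σ₂ ^ 2 * t.ofLp (1, i) ^ 2)) * hs
  rw [hq]
  simp
  ring

/-- The standardized errors `E₁ / σ₁` and `(E₂ - δ σ₂ E₁ / σ₁) / (σ₂ √(1 - δ²))` are independent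
standard Gaussian vectors, jointly independent of the treatment. -/
lemma IsMediationModel.hasLaw_standardized [IsProbabilityMeasure P] {A C B σ₁ σ₂ δ : ℝ}
    (hσ₁ : 0 < σ₁) (hσ₂ : 0 < σ₂) (hδ : δ ∈ Set.Ioo (-1 : ℝ) 1) {n : ℕ}
    {Z M R E₁ E₂ : Ω → Fin n → ℝ} (h : IsMediationModel P A C B σ₁ σ₂ δ Z M R E₁ E₂) :
    HasLaw (fun ω ↦ (Z ω, σ₁⁻¹ • E₁ ω,
        (σ₂ * √(1 - δ ^ 2))⁻¹ • (E₂ ω - (δ * σ₂) • σ₁⁻¹ • E₁ ω)))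
      ((P.map Z).prod ((Measure.pi fun _ : Fin n ↦ gaussianReal 0 1).prod
        (Measure.pi fun _ : Fin n ↦ gaussianReal 0 1))) P := by
  have hτ : 0 < σ₂ * √(1 - δ ^ 2) :=
    mul_pos hσ₂ (Real.sqrt_pos.2 (by nlinarith [hδ.1, hδ.2]))
  let f : EuclideanSpace ℝ (Fin 2 × Fin n) → (Fin n → ℝ) × (Fin n → ℝ) := fun e ↦
    (fun i ↦ σ₁⁻¹ * e (0, i),
      fun i ↦ (σ₂ * √(1 - δ ^ 2))⁻¹ * (e (1, i) - δ * σ₂ * (σ₁⁻¹ * e (0, i))))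
  have hf : Measurable f := by fun_prop
  have hfv : ∀ x y : Fin n → ℝ, f (vecErrors x y) =
      (σ₁⁻¹ • x, (σ₂ * √(1 - δ ^ 2))⁻¹ • (y - (δ * σ₂) • σ₁⁻¹ • x)) := by
    intro x y
    ext i <;> simp [f, vecErrors]
  -- The law of `f (vecErrors ..)` depends only on the law of the errors, so it may be computed on
  -- the Cholesky representation, which `f` inverts.
  have hlaw := HasLaw.comp_of_hasLaw_comp hf.aemeasurable
    (hasLaw_vecErrors_prod_gaussianReal ⟨hδ.1.le, hδ.2.le⟩ n) h.errors_law
    (ν := (Measure.pi fun _ : Fin n ↦ gaussianReal 0 1).prod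
        (Measure.pi fun _ : Fin n ↦ gaussianReal 0 1)) (by
      simp_rw [hfv]
      convert HasLaw.id using 1
      ext v i
      · simp [hσ₁.ne']
      · simp only [inv_smul_smul₀ hσ₁.ne', add_sub_cancel_left, inv_smul_smul₀ hτ.ne', id])
  have hind : IndepFun Z (fun ω ↦ f (vecErrors (E₁ ω) (E₂ ω))) P :=
    h.indep.comp measurable_id hf
  have hZ : HasLaw Z (P.map Z) P := ⟨h.aemeasurable_treatment, rfl⟩
  have := hind.hasLaw_prod hZ hlaw
  simpa only [hfv] using this

end StandardizedErrors

/-! ### Limits of the inner products of `Z`, `X` and `Y`. -/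

section GaussianDesign

open Complex

variable {Ω : Type*} [MeasurableSpace Ω] {P : Measure Ω}

lemma measurable_dotProduct_comp {α ι : Type*} [MeasurableSpace α] [Fintype ι] {f g : α → ι → ℝ}
    (hf : Measurable f) (hg : Measurable g) : Measurable fun a ↦ f a ⬝ᵥ g a := by
  unfold dotProduct; fun_prop

lemma aemeasurable_dotProduct_comp {ι : Type*} [Fintype ι] {f g : Ω → ι → ℝ}
    (hf : AEMeasurable f P) (hg : AEMeasurable g P) : AEMeasurable (fun a ↦ f a ⬝ᵥ g a) P := by
  have hm : Measurable fun v : (ι → ℝ) × (ι → ℝ) ↦ v.1 ⬝ᵥ v.2 :=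
    measurable_dotProduct_comp measurable_fst measurable_snd
  exact hm.comp_aemeasurable (hf.prodMk hg)

/-- Weak law of large numbers for the squared length of standard Gaussian vectors of growing
dimension. -/
lemma tendstoInMeasure_dotProduct_self_div [IsProbabilityMeasure P] {X : (n : ℕ) → Ω → Fin n → ℝ}
    (hX : ∀ n, HasLaw (X n) (Measure.pi fun _ : Fin n ↦ gaussianReal 0 1) P) :
    TendstoInMeasure P (fun n ω ↦ (X n ω ⬝ᵥ X n ω) / (n : ℝ)) atTop (fun _ ↦ 1) := by
  -- The fourth Gaussian moment makes the variance of `x ^ 2` finite, as Chebyshev's inequality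
  -- requires.
  have hL4 : MemLp (fun x : ℝ ↦ x ^ 2) 2 (gaussianReal 0 1) := by
    have h := memLp_id_gaussianReal (μ := 0) (v := 1) 4
    have h2 : MemLp (fun x : ℝ ↦ ‖id x‖ ^ (2 : ℝ)) (4 / 2) (gaussianReal 0 1) := by
      have := h.norm_rpow_div 2
      simpa using this
    have e : (4 / 2 : ENNReal) = 2 := by
      rw [show (4 : ENNReal) = 2 * 2 by norm_num, ENNReal.mul_div_cancel_right (by simp) (by simp)]
    rw [e] at h2
    refine h2.congr_norm (by fun_prop) (.of_forall fun x ↦ by simp)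
  have hint : ∫ x, x ^ 2 ∂(gaussianReal 0 1) = 1 := by
    have h := variance_id_gaussianReal (μ := 0) (v := 1)
    rw [variance_of_integral_eq_zero (by fun_prop) (by simp)] at h
    simpa using h
  set V := Var[fun x : ℝ ↦ x ^ 2; gaussianReal 0 1]
  have hmean : ∀ n, ∫ x, (∑ i, (fun y : Fin n → ℝ ↦ y i ^ 2)) x
      ∂(Measure.pi fun _ : Fin n ↦ gaussianReal 0 1) = n := by
    intro n
    simp only [Finset.sum_apply]
    rw [integral_finsetSum]
    · have : ∀ i : Fin n, ∫ x : Fin n → ℝ, x i ^ 2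
          ∂(Measure.pi fun _ : Fin n ↦ gaussianReal 0 1) = 1 := fun i ↦ by
        rw [integral_comp_eval (μ := fun _ : Fin n ↦ gaussianReal 0 1) (i := i)
          (f := fun x : ℝ ↦ x ^ 2) (by fun_prop), hint]
      simp [this]
    · intro i _
      exact integrable_comp_eval (μ := fun _ : Fin n ↦ gaussianReal 0 1)
        (f := fun x : ℝ ↦ x ^ 2) (hL4.integrable (by norm_num))
  have hvar : ∀ n, Var[∑ i, (fun y : Fin n → ℝ ↦ y i ^ 2);
      Measure.pi fun _ : Fin n ↦ gaussianReal 0 1] = n * V := fun n ↦ by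
    rw [variance_sum_pi (X := fun (_ : Fin n) (x : ℝ) ↦ x ^ 2) (fun _ ↦ hL4)]
    simp [V]
  have hmem : ∀ n, MemLp (∑ i, (fun y : Fin n → ℝ ↦ y i ^ 2)) 2
      (Measure.pi fun _ : Fin n ↦ gaussianReal 0 1) := fun n ↦
    memLp_finsetSum' _ fun i _ ↦ hL4.comp_measurePreserving
      (measurePreserving_eval (fun _ : Fin n ↦ gaussianReal 0 1) i)
  rw [tendstoInMeasure_iff_norm]
  intro ε hε
  have hlim : Tendsto (fun n : ℕ ↦ ENNReal.ofReal (V / ε ^ 2 / n)) atTop (𝓝 0) := by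
    rw [← ENNReal.ofReal_zero]
    exact ENNReal.tendsto_ofReal (tendsto_const_div_atTop_nhds_zero_nat _)
  refine tendsto_of_tendsto_of_tendsto_of_le_of_le' tendsto_const_nhds hlim
    (.of_forall fun _ ↦ zero_le) ?_
  filter_upwards [eventually_gt_atTop 0] with n hn
  have hn' : (0 : ℝ) < n := by exact_mod_cast hn
  have hc := meas_ge_le_variance_div_sq (hmem n) (c := n * ε) (by positivity)
  rw [hmean, hvar] at hc
  have hset : MeasurableSet {x : Fin n → ℝ | ε ≤ ‖(x ⬝ᵥ x) / (n : ℝ) - 1‖} :=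
    measurableSet_le measurable_const
      (((measurable_dotProduct_comp measurable_id measurable_id).div_const _).sub_const _).norm
  rw [(hX n).measure_eq hset]
  refine le_trans (measure_mono fun x hx ↦ ?_) (hc.trans (le_of_eq ?_))
  · simp only [Set.mem_ofPred_eq, Finset.sum_apply] at hx ⊢
    have h1 : (x ⬝ᵥ x) / (n : ℝ) - 1 = (∑ i, x i ^ 2 - n) / n := by
      simp only [dotProduct, ← pow_two]
      field_simp
    rw [h1, norm_div, Real.norm_eq_abs, Real.norm_eq_abs, abs_of_pos hn', le_div_iff₀ hn'] at hx
    linarith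
  · congr 1
    field_simp

/-- Regrouping lets `Y` be integrated out conditionally on the pair `(Z, X)`. -/
lemma hasLaw_prodAssoc_symm {n : ℕ} {Z X Y : Ω → Fin n → ℝ}
    (hlaw : HasLaw (fun ω ↦ (Z ω, X ω, Y ω))
      ((P.map Z).prod ((Measure.pi fun _ : Fin n ↦ gaussianReal 0 1).prod
        (Measure.pi fun _ : Fin n ↦ gaussianReal 0 1))) P) :
    HasLaw (fun ω ↦ ((Z ω, X ω), Y ω))
      (((P.map Z).prod (Measure.pi fun _ : Fin n ↦ gaussianReal 0 1)).prod
        (Measure.pi fun _ : Fin n ↦ gaussianReal 0 1)) P :=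
  ((measurePreserving_prodAssoc _ _ _).symm _).hasLaw.fun_comp hlaw

variable [IsProbabilityMeasure P] {Z X Y : (n : ℕ) → Ω → Fin n → ℝ} {q : ℝ}

lemma norm_exp_neg_div_two_le_one {x : ℝ} (hx : 0 ≤ x) : ‖cexp (-(x : ℂ) / 2)‖ ≤ 1 := by
  rw [Complex.norm_exp]
  simp
  linarith

lemma TendstoInMeasure.tendsto_integral_exp_neg_div_two {H : ℕ → Ω → ℝ} {h : ℝ}
    (hH : TendstoInMeasure P H atTop (fun _ ↦ h)) (hm : ∀ n, AEMeasurable (H n) P)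
    (h0 : ∀ n ω, 0 ≤ H n ω) :
    Tendsto (fun n ↦ ∫ ω, ‖cexp (-(H n ω : ℂ) / 2) - cexp (-(h : ℂ) / 2)‖ ∂P) atTop (𝓝 0) := by
  refine TendstoInMeasure.tendsto_integral_norm
    (TendstoInMeasure.comp_continuousAt hH (f := fun x : ℝ ↦ cexp (-(x : ℂ) / 2))
      (by fun_prop)) (fun n ↦ ?_) (K := 1)
    (fun n ↦ .of_forall fun ω ↦ norm_exp_neg_div_two_le_one (h0 n ω))
  exact ((by fun_prop : Measurable fun x : ℝ ↦ cexp (-(x : ℂ) / 2)).comp_aemeasurable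
    (hm n)).aestronglyMeasurable

/-- Since `‖e n ω‖ ≤ 1`, replacing `φ n` by `k` costs at most `∫ ‖φ n - k‖`. Hence `e n` need only
converge in mean; it may keep oscillating pointwise. -/
lemma tendsto_integral_mul_of_tendsto_integral_norm_sub {e φ : ℕ → Ω → ℂ} {k a : ℂ}
    (he : ∀ n, AEStronglyMeasurable (e n) P) (hφ : ∀ n, AEStronglyMeasurable (φ n) P)
    (he1 : ∀ n ω, ‖e n ω‖ ≤ 1) (hφ1 : ∀ n ω, ‖φ n ω‖ ≤ 1)
    (hφk : Tendsto (fun n ↦ ∫ ω, ‖φ n ω - k‖ ∂P) atTop (𝓝 0))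
    (hea : Tendsto (fun n ↦ ∫ ω, e n ω ∂P) atTop (𝓝 a)) :
    Tendsto (fun n ↦ ∫ ω, e n ω * φ n ω ∂P) atTop (𝓝 (a * k)) := by
  have ie : ∀ n, Integrable (e n) P := fun n ↦ .of_bound (he n) 1 (.of_forall (he1 n))
  have iφ : ∀ n, Integrable (φ n) P := fun n ↦ .of_bound (hφ n) 1 (.of_forall (hφ1 n))
  have iprod : ∀ n, Integrable (fun ω ↦ e n ω * φ n ω) P := fun n ↦
    .of_bound ((he n).mul (hφ n)) 1 (.of_forall fun ω ↦ by
      rw [norm_mul]; exact mul_le_one₀ (he1 n ω) (norm_nonneg _) (hφ1 n ω))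
  have hdiff : Tendsto (fun n ↦ ∫ ω, e n ω * φ n ω ∂P - (∫ ω, e n ω ∂P) * k) atTop (𝓝 0) := by
    refine squeeze_zero_norm (fun n ↦ ?_) hφk
    rw [← integral_mul_const, ← integral_sub (iprod n) ((ie n).mul_const k)]
    refine (norm_integral_le_integral_norm _).trans (integral_mono
      ((iprod n).sub ((ie n).mul_const k)).norm ((iφ n).sub (integrable_const k)).norm fun ω ↦ ?_)
    rw [← mul_sub, norm_mul]
    exact mul_le_of_le_one_left (norm_nonneg _) (he1 n ω)
  simpa using hdiff.add (hea.mul_const k)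

lemma tendsto_integral_of_tendsto_integral_norm_sub {φ : ℕ → Ω → ℂ} {k : ℂ}
    (hφ : ∀ n, AEStronglyMeasurable (φ n) P) (hφ1 : ∀ n ω, ‖φ n ω‖ ≤ 1)
    (hφk : Tendsto (fun n ↦ ∫ ω, ‖φ n ω - k‖ ∂P) atTop (𝓝 0)) :
    Tendsto (fun n ↦ ∫ ω, φ n ω ∂P) atTop (𝓝 k) := by
  simpa using tendsto_integral_mul_of_tendsto_integral_norm_sub (e := fun _ _ ↦ 1) (a := 1)
    (fun _ ↦ aestronglyMeasurable_const) hφ (by simp) hφ1 hφk (by simp)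

lemma hasLaw_treatment_fst {n : ℕ} {Z X Y : Ω → Fin n → ℝ}
    (hlaw : HasLaw (fun ω ↦ (Z ω, X ω, Y ω))
      ((P.map Z).prod ((Measure.pi fun _ : Fin n ↦ gaussianReal 0 1).prod
        (Measure.pi fun _ : Fin n ↦ gaussianReal 0 1))) P) :
    HasLaw (fun ω ↦ (Z ω, X ω))
      ((P.map Z).prod (Measure.pi fun _ : Fin n ↦ gaussianReal 0 1)) P := by
  have hZ : AEMeasurable Z P := measurable_fst.comp_aemeasurable hlaw.aemeasurable
  have := Measure.isProbabilityMeasure_map hZ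
  refine HasLaw.fun_comp (Y := fun v : (Fin n → ℝ) × (Fin n → ℝ) × (Fin n → ℝ) ↦ (v.1, v.2.1))
    (μ := (P.map Z).prod ((Measure.pi fun _ : Fin n ↦ gaussianReal 0 1).prod
        (Measure.pi fun _ : Fin n ↦ gaussianReal 0 1))) ⟨by fun_prop, ?_⟩ hlaw
  have := Measure.map_prod_map (P.map Z) ((Measure.pi fun _ : Fin n ↦ gaussianReal 0 1).prod
        (Measure.pi fun _ : Fin n ↦ gaussianReal 0 1)) measurable_id measurable_fst
  rw [Measure.map_id, Measure.map_fst_prod, measure_univ, one_smul] at this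
  exact this.symm

/-- The inner products of the treatment with independent Gaussian noise are `o(n)` in
probability. -/
lemma tendstoInMeasure_dotProduct_div
    (hlaw : ∀ n, HasLaw (fun ω ↦ (Z n ω, X n ω))
      ((P.map (Z n)).prod (Measure.pi fun _ : Fin n ↦ gaussianReal 0 1)) P)
    (hZ : TendstoInMeasure P (fun n ω ↦ (Z n ω ⬝ᵥ Z n ω) / (n : ℝ)) atTop (fun _ ↦ q)) :
    TendstoInMeasure P (fun n ω ↦ (Z n ω ⬝ᵥ X n ω) / (n : ℝ)) atTop (fun _ ↦ 0) := by
  have mZ : ∀ n, AEMeasurable (Z n) P := fun n ↦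
    measurable_fst.comp_aemeasurable (hlaw n).aemeasurable
  have mX : ∀ n, AEMeasurable (X n) P := fun n ↦
    measurable_snd.comp_aemeasurable (hlaw n).aemeasurable
  have mm : ∀ n, AEMeasurable (fun ω ↦ (Z n ω ⬝ᵥ X n ω) / (n : ℝ)) P := fun n ↦
    (aemeasurable_dotProduct_comp (mZ n) (mX n)).div_const _
  refine tendstoInMeasure_zero_of_tendsto_charFun mm fun t ↦ ?_
  have hn0 : TendstoInMeasure P (fun (n : ℕ) (_ : Ω) ↦ t ^ 2 / (n : ℝ)) atTop (fun _ ↦ 0) :=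
    tendstoInMeasure_of_tendsto_ae (fun _ ↦ aestronglyMeasurable_const)
      (.of_forall fun _ ↦ tendsto_const_div_atTop_nhds_zero_nat _)
  -- Given `Z`, this is `t ^ 2` times the variance of `ZᵀX / n`.
  have hH : TendstoInMeasure P
      (fun (n : ℕ) ω ↦ t ^ 2 / (n : ℝ) * ((Z n ω ⬝ᵥ Z n ω) / (n : ℝ))) atTop (fun _ ↦ 0 * q) := by
    have h := TendstoInMeasure.prodMk_const hn0 hZ
    have hc : ContinuousAt (fun v : ℝ × ℝ ↦ v.1 * v.2) (0, q) := by fun_prop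
    have h' := TendstoInMeasure.comp_continuousAt h hc
    exact h'
  have h0 : ∀ (n : ℕ) ω, 0 ≤ t ^ 2 / (n : ℝ) * ((Z n ω ⬝ᵥ Z n ω) / (n : ℝ)) := fun n ω ↦
    mul_nonneg (by positivity) (div_nonneg (dotProduct_self_star_nonneg _) (by positivity))
  have mH : ∀ n : ℕ, AEMeasurable
      (fun ω ↦ t ^ 2 / (n : ℝ) * ((Z n ω ⬝ᵥ Z n ω) / (n : ℝ))) P := fun n ↦
    ((aemeasurable_dotProduct_comp (mZ n) (mZ n)).div_const _).const_mul _
  have hlim := tendsto_integral_of_tendsto_integral_norm_sub (fun n ↦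
    ((by fun_prop : Measurable fun x : ℝ ↦ cexp (-(x : ℂ) / 2)).comp_aemeasurable
      (mH n)).aestronglyMeasurable) (fun n ω ↦ norm_exp_neg_div_two_le_one (h0 n ω))
    (TendstoInMeasure.tendsto_integral_exp_neg_div_two hH mH h0)
  simp only [zero_mul, ofReal_zero, neg_zero, zero_div, Complex.exp_zero] at hlim
  refine hlim.congr fun n ↦ ?_
  have := Measure.isProbabilityMeasure_map (mZ n)
  have key := (hlaw n).integral_mul_exp_dotProduct (f := fun _ ↦ 1) (by fun_prop) (by simp)
    (h := fun z ↦ (t / n) • z) (by fun_prop)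
  simp only [one_mul] at key
  rw [charFun_apply, integral_map (mm n) (by fun_prop)]
  have e1 : ∀ ω, t ^ 2 / (n : ℝ) * ((Z n ω ⬝ᵥ Z n ω) / (n : ℝ)) =
      ((t / (n : ℝ)) • Z n ω) ⬝ᵥ ((t / (n : ℝ)) • Z n ω) := fun ω ↦ by
    simp only [dotProduct_smul, smul_dotProduct, smul_eq_mul]
    ring
  have e2 : ∀ ω, inner ℝ ((Z n ω ⬝ᵥ X n ω) / (n : ℝ)) t =
      X n ω ⬝ᵥ ((t / (n : ℝ)) • Z n ω) := fun ω ↦ by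
    rw [dotProduct_smul, dotProduct_comm (X n ω), RCLike.inner_apply]
    simp only [smul_eq_mul, RCLike.conj_to_real]
    ring
  simp only [e1, e2]
  exact key.symm

/-- Joint asymptotic normality of the inner products of the treatment `Z` and the two standardized
error vectors `X`, `Y`. -/
lemma tendstoInDistribution_dotProducts (hq : 0 < q)
    (hlaw : ∀ n, HasLaw (fun ω ↦ (Z n ω, X n ω, Y n ω))
      ((P.map (Z n)).prod ((Measure.pi fun _ : Fin n ↦ gaussianReal 0 1).prod
        (Measure.pi fun _ : Fin n ↦ gaussianReal 0 1))) P)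
    (hZ : TendstoInMeasure P (fun n ω ↦ (Z n ω ⬝ᵥ Z n ω) / (n : ℝ)) atTop (fun _ ↦ q))
    (hX : TendstoInMeasure P (fun n ω ↦ (X n ω ⬝ᵥ X n ω) / (n : ℝ)) atTop (fun _ ↦ 1))
    (hZX : TendstoInMeasure P (fun n ω ↦ (Z n ω ⬝ᵥ X n ω) / (n : ℝ)) atTop (fun _ ↦ 0)) :
    TendstoInDistribution (fun (n : ℕ) ω ↦
        (!₂[(Z n ω ⬝ᵥ X n ω) / (√n * √q), (Z n ω ⬝ᵥ Y n ω) / (√n * √q), (X n ω ⬝ᵥ Y n ω) / √n] :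
          EuclideanSpace ℝ (Fin 3)))
      atTop (id : EuclideanSpace ℝ (Fin 3) → EuclideanSpace ℝ (Fin 3)) (fun _ ↦ P)
      (stdGaussian (EuclideanSpace ℝ (Fin 3))) := by
  have mZ : ∀ n, AEMeasurable (Z n) P := fun n ↦
    measurable_fst.comp_aemeasurable (hlaw n).aemeasurable
  have mX : ∀ n, AEMeasurable (X n) P := fun n ↦
    (measurable_fst.comp measurable_snd).comp_aemeasurable (hlaw n).aemeasurable
  have mY : ∀ n, AEMeasurable (Y n) P := fun n ↦
    (measurable_snd.comp measurable_snd).comp_aemeasurable (hlaw n).aemeasurable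
  have mW : ∀ n : ℕ, AEMeasurable (fun ω ↦
        (!₂[(Z n ω ⬝ᵥ X n ω) / (√n * √q), (Z n ω ⬝ᵥ Y n ω) / (√n * √q), (X n ω ⬝ᵥ Y n ω) / √n] :
          EuclideanSpace ℝ (Fin 3))) P := fun n ↦ by
    refine (WithLp.measurable_toLp 2 _).comp_aemeasurable (aemeasurable_pi_iff.2 fun i ↦ ?_)
    fin_cases i
    · exact (aemeasurable_dotProduct_comp (mZ n) (mX n)).div_const _
    · exact (aemeasurable_dotProduct_comp (mZ n) (mY n)).div_const _
    · exact (aemeasurable_dotProduct_comp (mX n) (mY n)).div_const _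
  refine ⟨mW, by fun_prop, ?_⟩
  refine ProbabilityMeasure.tendsto_of_tendsto_charFun fun t ↦ ?_
  simp only [ProbabilityMeasure.coe_mk, Measure.map_id, charFun_stdGaussian]
  have mexp : Measurable fun x : ℝ ↦ cexp (-(x : ℂ) / 2) := by fun_prop
  have sq_sqrt_q : √q * √q = q := Real.mul_self_sqrt hq.le
  have sq_sqrt_n : ∀ n : ℕ, √(n : ℝ) * √(n : ℝ) = n := fun n ↦ Real.mul_self_sqrt (by positivity)
  -- The conditional variance of the part that involves `Y`.
  let H : ℕ → Ω → ℝ := fun n ω ↦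
    (((t 1 / (√n * √q)) • Z n ω + (t 2 / √n) • X n ω) ⬝ᵥ
      ((t 1 / (√n * √q)) • Z n ω + (t 2 / √n) • X n ω))
  have hH : TendstoInMeasure P H atTop (fun _ ↦ t 1 ^ 2 + t 2 ^ 2) := by
    have hXZX := TendstoInMeasure.prodMk_const hX hZX
    have hpair := TendstoInMeasure.prodMk_const hZ hXZX
    -- The last term is the conditional covariance of `ZᵀY` and `XᵀY`, proportional to `ZᵀX / n`; it
    -- vanishes in the limit and makes these coordinates asymptotically independent.
    have hc : ContinuousAt (fun v : ℝ × ℝ × ℝ ↦ t 1 ^ 2 / q * v.1 + t 2 ^ 2 * v.2.1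
          + 2 * t 1 * t 2 / √q * v.2.2) (q, 1, 0) := by fun_prop
    have h := TendstoInMeasure.comp_continuousAt hpair hc
    simp only [div_mul_cancel₀ _ hq.ne', mul_one, mul_zero, add_zero] at h
    convert h using 3 with n ω
    simp only [H, add_dotProduct, dotProduct_add, smul_dotProduct, dotProduct_smul, smul_eq_mul,
      dotProduct_comm (X n ω) (Z n ω)]
    rw [← sq_sqrt_n n, ← sq_sqrt_q, Real.sqrt_mul_self (Real.sqrt_nonneg _),
      Real.sqrt_mul_self (Real.sqrt_nonneg _)]
    rcases Nat.eq_zero_or_pos n with rfl | hn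
    · simp
    · have : 0 < √(n : ℝ) := Real.sqrt_pos.2 (by exact_mod_cast hn)
      have : 0 < √q := Real.sqrt_pos.2 hq
      field_simp
      ring
  have mH : ∀ n, AEMeasurable (H n) P := fun n ↦ by
    have := mZ n
    have := mX n
    refine aemeasurable_dotProduct_comp ?_ ?_ <;> fun_prop
  have H0 : ∀ n ω, 0 ≤ H n ω := fun n ω ↦ dotProduct_self_star_nonneg _
  -- The conditional variance, given `Z`, of the part that involves `X` alone.
  let G : ℕ → Ω → ℝ := fun n ω ↦
    ((t 0 / (√n * √q)) • Z n ω) ⬝ᵥ ((t 0 / (√n * √q)) • Z n ω)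
  have hG : TendstoInMeasure P G atTop (fun _ ↦ t 0 ^ 2) := by
    have hc : ContinuousAt (fun v : ℝ ↦ t 0 ^ 2 / q * v) q := by fun_prop
    have h := TendstoInMeasure.comp_continuousAt hZ hc
    simp only [div_mul_cancel₀ _ hq.ne'] at h
    convert h using 3 with n ω
    simp only [G, smul_dotProduct, dotProduct_smul, smul_eq_mul]
    rw [← sq_sqrt_n n, ← sq_sqrt_q, Real.sqrt_mul_self (Real.sqrt_nonneg _),
      Real.sqrt_mul_self (Real.sqrt_nonneg _)]
    ring
  have mG : ∀ n, AEMeasurable (G n) P := fun n ↦ by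
    have := mZ n
    refine aemeasurable_dotProduct_comp ?_ ?_ <;> fun_prop
  have G0 : ∀ n ω, 0 ≤ G n ω := fun n ω ↦ dotProduct_self_star_nonneg _
  let e : ℕ → Ω → ℂ := fun n ω ↦ cexp (((X n ω ⬝ᵥ ((t 0 / (√n * √q)) • Z n ω) : ℝ) : ℂ) * I)
  have hprob : ∀ n, IsProbabilityMeasure (P.map (Z n)) := fun n ↦
    Measure.isProbabilityMeasure_map (mZ n)
  have he : Tendsto (fun n ↦ ∫ ω, e n ω ∂P) atTop (𝓝 (cexp (-((t 0 ^ 2 : ℝ) : ℂ) / 2))) := by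
    refine (tendsto_integral_of_tendsto_integral_norm_sub
      (fun n ↦ (mexp.comp_aemeasurable (mG n)).aestronglyMeasurable)
      (fun n ω ↦ norm_exp_neg_div_two_le_one (G0 n ω))
      (TendstoInMeasure.tendsto_integral_exp_neg_div_two hG mG G0)).congr fun n ↦ ?_
    have key := (hasLaw_treatment_fst (hlaw n)).integral_mul_exp_dotProduct (f := fun _ ↦ 1)
      (by fun_prop) (by simp) (h := fun z ↦ (t 0 / (√n * √q)) • z) (by fun_prop)
    simp only [one_mul] at key
    exact key.symm
  have hlim := tendsto_integral_mul_of_tendsto_integral_norm_sub (e := e) (fun n ↦ by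
      have : Measurable fun x : ℝ ↦ cexp ((x : ℂ) * I) := by fun_prop
      have h' := mZ n
      exact (this.comp_aemeasurable (aemeasurable_dotProduct_comp (mX n)
        (by fun_prop))).aestronglyMeasurable)
    (fun n ↦ (mexp.comp_aemeasurable (mH n)).aestronglyMeasurable)
    (fun n ω ↦ (Complex.norm_exp_ofReal_mul_I _).le)
    (fun n ω ↦ norm_exp_neg_div_two_le_one (H0 n ω))
    (TendstoInMeasure.tendsto_integral_exp_neg_div_two hH mH H0) he
  have hend : cexp (-((t 0 ^ 2 : ℝ) : ℂ) / 2) * cexp (-((t 1 ^ 2 + t 2 ^ 2 : ℝ) : ℂ) / 2) =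
      cexp (-(‖t‖ : ℂ) ^ 2 / 2) := by
    rw [← Complex.exp_add, ← ofReal_pow, EuclideanSpace.real_norm_sq_eq, Fin.sum_univ_three]
    congr 1
    push_cast
    ring
  rw [← hend]
  refine hlim.congr fun n ↦ ?_
  -- Conditioning on `(Z, X)`: the `ZᵀX` phase is the fixed factor `f`, and only the terms in `Y`
  -- are averaged.
  have key := (hasLaw_prodAssoc_symm (hlaw n)).integral_mul_exp_dotProduct
    (f := fun v ↦ cexp (((v.2 ⬝ᵥ ((t 0 / (√n * √q)) • v.1) : ℝ) : ℂ) * I))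
    (by unfold dotProduct; fun_prop)
    (fun v ↦ (Complex.norm_exp_ofReal_mul_I _).le)
    (h := fun v ↦ (t 1 / (√n * √q)) • v.1 + (t 2 / √n) • v.2) (by fun_prop)
  rw [charFun_apply, integral_map (mW n) (by fun_prop)]
  refine key.symm.trans (integral_congr_ae (.of_forall fun ω ↦ ?_))
  simp only
  rw [← Complex.exp_add, ← add_mul, ← ofReal_add]
  congr 3
  simp only [PiLp.inner_apply, Fin.sum_univ_three, dotProduct_add, dotProduct_smul, smul_eq_mul,
    dotProduct_comm (X n ω) (Z n ω), dotProduct_comm (Y n ω) (Z n ω),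
    dotProduct_comm (Y n ω) (X n ω)]
  simp
  ring

end GaussianDesign

/-! ### Algebra of the estimators and the limit covariance. -/

section Estimators

/-- Eliminating the mediator gives `R = (C + A B) Z + (B σ₁ + κ) X + τ Y`. -/
lemma totalEffectEst_sub {n : ℕ} {Z X Y M R : Fin n → ℝ} {A B C σ₁ κ τ : ℝ}
    (hM : M = A • Z + σ₁ • X) (hR : R = C • Z + B • M + (κ • X + τ • Y)) (hZ : Z ⬝ᵥ Z ≠ 0) :
    totalEffectEst Z R - (C + A * B) =
      ((B * σ₁ + κ) * (Z ⬝ᵥ X) + τ * (Z ⬝ᵥ Y)) / (Z ⬝ᵥ Z) := by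
  subst hM hR
  simp only [totalEffectEst, dotProduct_add, dotProduct_smul, smul_eq_mul]
  field_simp
  ring

/-- As `X = (M - A Z) / σ₁`, regressing `R` on `Z` and `M` has bias `-δ σ₂ A / σ₁` in the
coefficient of `Z`. The correction term in the estimator cancels it and leaves the noise `δ σ₂ ZᵀX /
ZᵀZ`. -/
lemma directEffectEst_sub {n : ℕ} {Z X Y M R : Fin n → ℝ} {A B C σ₁ σ₂ δ τ : ℝ} (hσ₁ : σ₁ ≠ 0)
    (hM : M = A • Z + σ₁ • X) (hR : R = C • Z + B • M + ((δ * σ₂) • X + τ • Y))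
    (hZ : Z ⬝ᵥ Z ≠ 0) (hD : (Z ⬝ᵥ Z) * (X ⬝ᵥ X) - (Z ⬝ᵥ X) ^ 2 ≠ 0) :
    directEffectEst σ₁ σ₂ δ Z M R - C = δ * σ₂ * (Z ⬝ᵥ X) / (Z ⬝ᵥ Z) +
      τ * ((σ₁ * (X ⬝ᵥ X) + A * (Z ⬝ᵥ X)) * (Z ⬝ᵥ Y) - (A * (Z ⬝ᵥ Z) + σ₁ * (Z ⬝ᵥ X)) * (X ⬝ᵥ Y)) /
        (σ₁ * ((Z ⬝ᵥ Z) * (X ⬝ᵥ X) - (Z ⬝ᵥ X) ^ 2)) := by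
  subst hM hR
  simp only [directEffectEst, dotProduct_add, dotProduct_smul, add_dotProduct, smul_dotProduct,
    smul_eq_mul, dotProduct_comm X Z]
  generalize Z ⬝ᵥ Z = s at *
  generalize Z ⬝ᵥ X = p at *
  generalize Z ⬝ᵥ Y = r at *
  generalize X ⬝ᵥ X = g at *
  generalize X ⬝ᵥ Y = m at *
  -- The Gram determinant of `(Z, M)` is `σ₁ ^ 2` times that of `(Z, X)`, since `M - σ₁ X` is a
  -- multiple of `Z`.
  have hden : s * (A * (A * s + σ₁ * p) + σ₁ * (A * p + σ₁ * g)) -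
      (A * s + σ₁ * p) * (A * s + σ₁ * p) = σ₁ ^ 2 * (s * g - p ^ 2) := by ring
  rw [hden]
  field_simp
  ring

/-- The linear map that sends the limiting Gaussian vector to the limit of the scaled estimation
errors, with coefficients `c`. -/
noncomputable def effectsLimit (B σ₁ κ τ : ℝ) (v : EuclideanSpace ℝ (Fin 3) × ℝ × ℝ × ℝ) :
    EuclideanSpace ℝ (Fin 2) :=
  !₂[(B * σ₁ + κ) * v.2.1 * v.1 0 + τ * v.2.1 * v.1 1,
    κ * v.2.1 * v.1 0 + τ * v.2.2.1 * v.1 1 - τ * v.2.2.2 * v.1 2]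

lemma continuous_effectsLimit (B σ₁ κ τ : ℝ) : Continuous (effectsLimit B σ₁ κ τ) := by
  unfold effectsLimit
  refine (PiLp.continuous_toLp 2 _).comp (continuous_pi fun i ↦ ?_)
  fin_cases i
  · simp only [Fin.zero_eta, Matrix.cons_val_zero]; fun_prop
  · simp only [Fin.mk_one, Matrix.cons_val_one, Matrix.cons_val_zero]; fun_prop

/-- The coefficients in `effectsLimit`, as a function of `ZᵀZ / n`, `XᵀX / n` and `ZᵀX / n`. -/
noncomputable def effectsCoeff (A σ₁ q : ℝ) (c : ℝ × ℝ × ℝ) : ℝ × ℝ × ℝ :=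
  (√q / c.1, √q * (σ₁ * c.2.1 + A * c.2.2) / (σ₁ * (c.1 * c.2.1 - c.2.2 ^ 2)),
    (A * c.1 + σ₁ * c.2.2) / (σ₁ * (c.1 * c.2.1 - c.2.2 ^ 2)))

lemma measurable_effectsCoeff (A σ₁ q : ℝ) : Measurable (effectsCoeff A σ₁ q) := by
  unfold effectsCoeff
  fun_prop

lemma continuousAt_effectsCoeff {A σ₁ q : ℝ} (hσ₁ : σ₁ ≠ 0) (hq : 0 < q) :
    ContinuousAt (effectsCoeff A σ₁ q) (q, 1, 0) := by
  have hq' := hq.ne'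
  unfold effectsCoeff
  refine ContinuousAt.prodMk ?_ (ContinuousAt.prodMk ?_ ?_)
  · exact ContinuousAt.div₀ (by fun_prop) (by fun_prop) hq'
  · exact ContinuousAt.div₀ (by fun_prop) (by fun_prop) (by simp [hσ₁, hq'])
  · exact ContinuousAt.div₀ (by fun_prop) (by fun_prop) (by simp [hσ₁, hq'])

lemma effectsCoeff_limit {A σ₁ q : ℝ} (hσ₁ : σ₁ ≠ 0) (hq : 0 < q) :
    effectsCoeff A σ₁ q (q, 1, 0) = (1 / √q, 1 / √q, A / σ₁) := by
  have h : √q * √q = q := Real.mul_self_sqrt hq.le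
  have h0 : √q ≠ 0 := (Real.sqrt_pos.2 hq).ne'
  have hq' := hq.ne'
  simp only [effectsCoeff, Prod.mk.injEq]
  refine ⟨?_, ?_, ?_⟩
  · rw [div_eq_div_iff hq' h0]; linarith
  · rw [div_eq_div_iff (by simp [hσ₁, hq']) h0]
    linear_combination σ₁ * h
  · rw [div_eq_div_iff (by simp [hσ₁, hq']) hσ₁]
    ring

/-- The scaled estimation errors as the linear map `effectsLimit` with random coefficients. -/
lemma sqrt_smul_estimators_sub_eq {n : ℕ} (hn : 0 < n) {Z X Y M R : Fin n → ℝ}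
    {A B C σ₁ σ₂ δ τ q : ℝ} (hσ₁ : σ₁ ≠ 0) (hq : 0 < q)
    (hM : M = A • Z + σ₁ • X) (hR : R = C • Z + B • M + ((δ * σ₂) • X + τ • Y))
    (hZ : (Z ⬝ᵥ Z) / (n : ℝ) ≠ 0)
    (hD : (Z ⬝ᵥ Z) / (n : ℝ) * ((X ⬝ᵥ X) / (n : ℝ)) - ((Z ⬝ᵥ X) / (n : ℝ)) ^ 2 ≠ 0) :
    √n • ((!₂[totalEffectEst Z R, directEffectEst σ₁ σ₂ δ Z M R] : EuclideanSpace ℝ (Fin 2)) -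
        !₂[C + A * B, C]) =
      effectsLimit B σ₁ (δ * σ₂) τ
        (!₂[(Z ⬝ᵥ X) / (√n * √q), (Z ⬝ᵥ Y) / (√n * √q), (X ⬝ᵥ Y) / √n],
          effectsCoeff A σ₁ q ((Z ⬝ᵥ Z) / (n : ℝ), (X ⬝ᵥ X) / (n : ℝ), (Z ⬝ᵥ X) / (n : ℝ))) := by
  have hn' : (n : ℝ) ≠ 0 := by exact_mod_cast hn.ne'
  have hZ' : Z ⬝ᵥ Z ≠ 0 := fun h ↦ hZ (by simp [h])
  have hD' : (Z ⬝ᵥ Z) * (X ⬝ᵥ X) - (Z ⬝ᵥ X) ^ 2 ≠ 0 := fun h ↦ hD (by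
    field_simp
    linarith)
  have e1 := totalEffectEst_sub hM hR hZ'
  have e2 := directEffectEst_sub hσ₁ hM hR hZ' hD'
  have hden : (Z ⬝ᵥ Z) / (n : ℝ) * ((X ⬝ᵥ X) / (n : ℝ)) - ((Z ⬝ᵥ X) / (n : ℝ)) ^ 2 =
      ((Z ⬝ᵥ Z) * (X ⬝ᵥ X) - (Z ⬝ᵥ X) ^ 2) / (n : ℝ) ^ 2 := by field_simp
  have hb : (n : ℝ) = √n ^ 2 := (Real.sq_sqrt (by positivity)).symm
  have ha0 : √q ≠ 0 := (Real.sqrt_pos.2 hq).ne'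
  have hb0 : √(n : ℝ) ≠ 0 := (Real.sqrt_pos.2 (by exact_mod_cast hn)).ne'
  ext i
  fin_cases i
  · simp [effectsLimit, effectsCoeff, e1]
    generalize √(n : ℝ) = b at *
    rw [hb]
    field_simp
  · simp [effectsLimit, effectsCoeff, e2, hden]
    generalize √(n : ℝ) = b at *
    rw [hb]
    field_simp
    ring

/-- The squares are those of the coordinates of the transposed limiting linear map at `t`. This
yields both positivity and the limiting characteristic function. -/
lemma effectsAsympCov_dotProduct_mulVec {A B σ₁ σ₂ δ q : ℝ} (hσ₁ : 0 < σ₁)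
    (hδ : δ ∈ Set.Ioo (-1 : ℝ) 1) (hq : 0 < q) (t : Fin 2 → ℝ) :
    t ⬝ᵥ effectsAsympCov A B σ₁ σ₂ δ q *ᵥ t =
      (((B * σ₁ + δ * σ₂) * (1 / √q)) * t 0 + (δ * σ₂ * (1 / √q)) * t 1) ^ 2 +
        (σ₂ * √(1 - δ ^ 2) * (1 / √q) * (t 0 + t 1)) ^ 2 +
        (σ₂ * √(1 - δ ^ 2) * (A / σ₁) * t 1) ^ 2 := by
  have hs : √(1 - δ ^ 2) ^ 2 = 1 - δ ^ 2 := Real.sq_sqrt (by nlinarith [hδ.1, hδ.2])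
  have hqs : √q ^ 2 = q := Real.sq_sqrt hq.le
  simp only [effectsAsympCov, dotProduct, mulVec, Fin.sum_univ_two, of_apply, cons_val', cons_val_zero,
    cons_val_one, cons_val_fin_one, mul_pow, add_sq, div_pow, hs, hqs, one_pow]
  field_simp
  simp only [hqs]
  ring

lemma effectsAsympCov_posSemidef {A B σ₁ σ₂ δ q : ℝ} (hσ₁ : 0 < σ₁)
    (hδ : δ ∈ Set.Ioo (-1 : ℝ) 1) (hq : 0 < q) :
    (effectsAsympCov A B σ₁ σ₂ δ q).PosSemidef := by
  refine Matrix.PosSemidef.of_dotProduct_mulVec_nonneg ?_ fun t ↦ ?_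
  · ext i j
    fin_cases i <;> fin_cases j <;> simp [effectsAsympCov]
  · rw [star_trivial, effectsAsympCov_dotProduct_mulVec hσ₁ hδ hq]
    positivity

/-- The law of the limit of the scaled estimation errors. -/
lemma map_effectsLimit_stdGaussian {A B σ₁ σ₂ δ q : ℝ} (hσ₁ : 0 < σ₁)
    (hδ : δ ∈ Set.Ioo (-1 : ℝ) 1) (hq : 0 < q) :
    (stdGaussian (EuclideanSpace ℝ (Fin 3))).map (fun w ↦
        effectsLimit B σ₁ (δ * σ₂) (σ₂ * √(1 - δ ^ 2)) (w, 1 / √q, 1 / √q, A / σ₁)) =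
      multivariateGaussian 0 (effectsAsympCov A B σ₁ σ₂ δ q) := by
  have hm : Measurable fun w : EuclideanSpace ℝ (Fin 3) ↦
      effectsLimit B σ₁ (δ * σ₂) (σ₂ * √(1 - δ ^ 2)) (w, 1 / √q, 1 / √q, A / σ₁) :=
    ((continuous_effectsLimit _ _ _ _).comp (by fun_prop)).measurable
  have := Measure.isProbabilityMeasure_map hm.aemeasurable
    (μ := stdGaussian (EuclideanSpace ℝ (Fin 3)))
  apply Measure.ext_of_charFun
  ext t
  rw [charFun_multivariateGaussian (effectsAsympCov_posSemidef hσ₁ hδ hq),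
    effectsAsympCov_dotProduct_mulVec hσ₁ hδ hq, charFun_apply,
    integral_map hm.aemeasurable (by fun_prop)]
  -- The adjoint of the limiting linear map at `t`.
  let u : EuclideanSpace ℝ (Fin 3) :=
    !₂[((B * σ₁ + δ * σ₂) * (1 / √q)) * t 0 + (δ * σ₂ * (1 / √q)) * t 1,
      σ₂ * √(1 - δ ^ 2) * (1 / √q) * (t 0 + t 1), -(σ₂ * √(1 - δ ^ 2) * (A / σ₁) * t 1)]
  have hu : ∀ w : EuclideanSpace ℝ (Fin 3),
      inner ℝ (effectsLimit B σ₁ (δ * σ₂) (σ₂ * √(1 - δ ^ 2)) (w, 1 / √q, 1 / √q, A / σ₁)) t =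
        inner ℝ w u := by
    intro w
    simp only [PiLp.inner_apply, Fin.sum_univ_two, Fin.sum_univ_three, effectsLimit, u]
    simp
    ring
  simp_rw [hu]
  rw [← charFun_apply, charFun_stdGaussian, ← Complex.ofReal_pow, EuclideanSpace.real_norm_sq_eq,
    Fin.sum_univ_three]
  congr 1
  simp [u]
  ring

end Estimators

/-! ### Assembly by Slutsky's theorem. -/

theorem theorem3 {Ω : Type*} [MeasurableSpace Ω] (P : Measure Ω) [IsProbabilityMeasure P]
    (A C B σ₁ σ₂ δ q : ℝ) (hσ₁ : 0 < σ₁) (hσ₂ : 0 < σ₂) (hδ : δ ∈ Set.Ioo (-1 : ℝ) 1) (hq : 0 < q)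
    (Z M R E₁ E₂ : (n : ℕ) → Ω → Fin n → ℝ)
    (hmodel : ∀ n, IsMediationModel P A C B σ₁ σ₂ δ (Z n) (M n) (R n) (E₁ n) (E₂ n))
    (hZ : TendstoInMeasure P (fun n ω => (Z n ω ⬝ᵥ Z n ω) / (n : ℝ)) atTop (fun _ => q)) :
    (effectsAsympCov A B σ₁ σ₂ δ q).PosSemidef ∧
    TendstoInDistribution
      (fun (n : ℕ) ω => Real.sqrt n •
        ((!₂[totalEffectEst (Z n ω) (R n ω), directEffectEst σ₁ σ₂ δ (Z n ω) (M n ω) (R n ω)] :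
            EuclideanSpace ℝ (Fin 2))
          - !₂[C + A * B, C]))
      atTop (id : EuclideanSpace ℝ (Fin 2) → EuclideanSpace ℝ (Fin 2))
      (fun _ => P) (multivariateGaussian 0 (effectsAsympCov A B σ₁ σ₂ δ q)) := by
  refine ⟨effectsAsympCov_posSemidef hσ₁ hδ hq, ?_⟩
  have hτ : 0 < σ₂ * √(1 - δ ^ 2) :=
    mul_pos hσ₂ (Real.sqrt_pos.2 (by nlinarith [hδ.1, hδ.2]))
  set τ := σ₂ * √(1 - δ ^ 2) with hτ_def
  let X : (n : ℕ) → Ω → Fin n → ℝ := fun n ω ↦ σ₁⁻¹ • E₁ n ω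
  let Y : (n : ℕ) → Ω → Fin n → ℝ := fun n ω ↦ τ⁻¹ • (E₂ n ω - (δ * σ₂) • σ₁⁻¹ • E₁ n ω)
  have hlaw : ∀ n, HasLaw (fun ω ↦ (Z n ω, X n ω, Y n ω))
      ((P.map (Z n)).prod ((Measure.pi fun _ : Fin n ↦ gaussianReal 0 1).prod
        (Measure.pi fun _ : Fin n ↦ gaussianReal 0 1))) P :=
    fun n ↦ (hmodel n).hasLaw_standardized hσ₁ hσ₂ hδ
  have hE₁ : ∀ n ω, E₁ n ω = σ₁ • X n ω := fun n ω ↦ (smul_inv_smul₀ hσ₁.ne' _).symm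
  have hE₂ : ∀ n ω, E₂ n ω = (δ * σ₂) • X n ω + τ • Y n ω := fun n ω ↦ by
    simp only [X, Y, smul_inv_smul₀ hτ.ne', add_sub_cancel]
  have mZ : ∀ n, AEMeasurable (Z n) P := fun n ↦ (hmodel n).aemeasurable_treatment
  have mX : ∀ n, AEMeasurable (X n) P := fun n ↦
    (measurable_fst.comp measurable_snd).comp_aemeasurable (hlaw n).aemeasurable
  have mY : ∀ n, AEMeasurable (Y n) P := fun n ↦
    (measurable_snd.comp measurable_snd).comp_aemeasurable (hlaw n).aemeasurable
  have hM : ∀ n, ∀ᵐ ω ∂P, M n ω = A • Z n ω + σ₁ • X n ω := fun n ↦ by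
    filter_upwards [(hmodel n).mediator_eq] with ω hω
    rw [hω, hE₁]
  have hR : ∀ n, ∀ᵐ ω ∂P, R n ω = C • Z n ω + B • M n ω + ((δ * σ₂) • X n ω + τ • Y n ω) :=
    fun n ↦ by
      filter_upwards [(hmodel n).outcome_eq] with ω hω
      rw [hω, hE₂]
  -- Measurability of `M` and `R` is inherited from `Z`, `X`, `Y` through the model equations.
  have mM : ∀ n, AEMeasurable (M n) P := fun n ↦ by
    have h1 := mZ n
    have h2 := mX n
    exact (by fun_prop : AEMeasurable (fun ω ↦ A • Z n ω + σ₁ • X n ω) P).congr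
      (EventuallyEq.symm (hM n))
  have mR : ∀ n, AEMeasurable (R n) P := fun n ↦ by
    have h1 := mZ n
    have h2 := mX n
    have h3 := mY n
    have h4 := mM n
    exact (by fun_prop : AEMeasurable (fun ω ↦ C • Z n ω + B • M n ω +
      ((δ * σ₂) • X n ω + τ • Y n ω)) P).congr (EventuallyEq.symm (hR n))
  have hX : TendstoInMeasure P (fun n ω ↦ (X n ω ⬝ᵥ X n ω) / (n : ℝ)) atTop (fun _ ↦ 1) := by
    refine tendstoInMeasure_dotProduct_self_div fun n ↦ ?_
    have := Measure.isProbabilityMeasure_map (mZ n)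
    exact HasLaw.fun_comp (Y := Prod.snd) ⟨by fun_prop, by simp⟩ (hasLaw_treatment_fst (hlaw n))
  have hZX := tendstoInMeasure_dotProduct_div (fun n ↦ hasLaw_treatment_fst (hlaw n)) hZ
  have hXZX := TendstoInMeasure.prodMk_const hX hZX
  have hc := TendstoInMeasure.prodMk_const hZ hXZX
  have hcoeff := TendstoInMeasure.comp_continuousAt hc
    (continuousAt_effectsCoeff (A := A) hσ₁.ne' hq)
  rw [effectsCoeff_limit hσ₁.ne' hq] at hcoeff
  have mcoeff : ∀ n : ℕ, AEMeasurable (fun ω ↦ effectsCoeff A σ₁ q ((Z n ω ⬝ᵥ Z n ω) / (n : ℝ),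
      (X n ω ⬝ᵥ X n ω) / (n : ℝ), (Z n ω ⬝ᵥ X n ω) / (n : ℝ))) P := fun n ↦
    (measurable_effectsCoeff A σ₁ q).comp_aemeasurable
      (((aemeasurable_dotProduct_comp (mZ n) (mZ n)).div_const _).prodMk
        (((aemeasurable_dotProduct_comp (mX n) (mX n)).div_const _).prodMk
          ((aemeasurable_dotProduct_comp (mZ n) (mX n)).div_const _)))
  have hlin := (tendstoInDistribution_dotProducts hq hlaw hZ hX
    hZX).continuous_comp_prodMk_of_tendstoInMeasure_const
      (continuous_effectsLimit B σ₁ (δ * σ₂) τ) hcoeff mcoeff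
  have hest : ∀ n : ℕ, AEMeasurable (fun ω ↦ √n •
        ((!₂[totalEffectEst (Z n ω) (R n ω), directEffectEst σ₁ σ₂ δ (Z n ω) (M n ω) (R n ω)] :
            EuclideanSpace ℝ (Fin 2)) - !₂[C + A * B, C])) P := fun n ↦ by
    have h : AEMeasurable (fun ω ↦
        (!₂[totalEffectEst (Z n ω) (R n ω), directEffectEst σ₁ σ₂ δ (Z n ω) (M n ω) (R n ω)] :
            EuclideanSpace ℝ (Fin 2))) P := by
      refine (WithLp.measurable_toLp 2 _).comp_aemeasurable (aemeasurable_pi_iff.2 fun i ↦ ?_)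
      have h1 := aemeasurable_dotProduct_comp (mZ n) (mZ n)
      have h2 := aemeasurable_dotProduct_comp (mZ n) (mM n)
      have h3 := aemeasurable_dotProduct_comp (mZ n) (mR n)
      have h4 := aemeasurable_dotProduct_comp (mM n) (mM n)
      have h5 := aemeasurable_dotProduct_comp (mM n) (mR n)
      have h6 := aemeasurable_dotProduct_comp (mM n) (mZ n)
      fin_cases i
      · exact h3.div h1
      · exact (((h4.mul h3).sub (h2.mul h5)).div ((h1.mul h4).sub (h6.mul h2))).add
          ((h2.const_mul _).div (h1.const_mul _))
    fun_prop
  -- The algebraic identity needs nonzero denominators. This holds near `(q, 1, 0)`, hence off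
  -- events of vanishing probability, which do not affect the limit law.
  have hU : {c : ℝ × ℝ × ℝ | c.1 ≠ 0 ∧ c.1 * c.2.1 - c.2.2 ^ 2 ≠ 0} ∈ 𝓝 (q, (1 : ℝ), (0 : ℝ)) := by
    refine IsOpen.mem_nhds ?_ ⟨hq.ne', by simp [hq.ne']⟩
    exact (isOpen_ne_fun (by fun_prop) (by fun_prop)).inter
      (isOpen_ne_fun (by fun_prop) (by fun_prop))
  have hS := TendstoInMeasure.tendsto_measure_notMem hc hU
  have hmain := tendstoInDistribution_of_tendstoInMeasure_sub _ _ hlin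
    (tendstoInMeasure_zero_of_tendsto_measure_ne hS (by
      filter_upwards [eventually_gt_atTop 0] with n hn
      filter_upwards [hM n, hR n] with ω hMω hRω hω
      have hω' := not_not.1 hω
      exact sub_eq_zero.2 (sqrt_smul_estimators_sub_eq hn hσ₁.ne' hq hMω hRω hω'.1 hω'.2))) hest
  refine ⟨hest, by fun_prop, ?_⟩
  convert hmain.tendsto using 2
  refine congrArg 𝓝 (Subtype.ext ?_)
  simp only [Measure.map_id, hτ_def]
  exact (map_effectsLimit_stdGaussian hσ₁ hδ hq).symm
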